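/- Call a probability distribution $\mu$ on $\mathbb{R}$ \emph{proper} if for $X\sim\mu$ one has $\mathbb{E}[X]=0$, $\mathbb{E}[X^2]=1$ and $\mathbb{E}[X^3]=0$, and \emph{hypercontractive} if there is a constant $c$ such that for all $m$, all $u\in\mathbb{R}^m$ and all real $q\ge 2$, $$\left(\mathbb{E}_{X\sim\mu^m}|\langle u,X\rangle|^q\right)^{1/q}\le c\sqrt{q}\,\left(\mathbb{E}_{X\sim\mu^m}|\langle u,X\rangle|^2\right)^{1/2}.$$ A matrix $W\in\mathbb{R}^{n\times k}$ is \emph{$\epsilon$-regular} if every column $u$ of $W$ satisfies $\sum_{i=1}^n u_i^4\le\epsilon^2\|u\|_2^2$. For a smooth function $\psi:\mathbb{R}^k\to\mathbb{R}$ put $$\|\psi^{(4)}\|_1=\sup_{a\in\mathbb{R}^k}\ \sum_{p,q,r,s=1}^k|\partial_p\partial_q\partial_r\partial_s\psi(a)|.$$ Theorem. Let $\mu$ be a proper and hypercontractive distribution on $\mathbb{R}$ and let $\epsilon_0<1$. There is a constant $C>0$, depending only on $\mu$ and $\epsilon_0$, such that the following holds. Let $n\ge 1$, $k\ge 2$,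 $0<\epsilon\le\epsilon_0$, let $W\in\mathbb{R}^{n\times k}$ be $\epsilon$-regular with columns of Euclidean norm one, and let $\psi:\mathbb{R}^k\to\mathbb{R}$ be a smooth ($C^\infty$) function with $\|\psi^{(4)}\|_1<\infty$. Then $\psi(W^TX)$ and $\psi(W^TY)$ are integrable for $X\sim\mu^n$ and $Y\sim\mathcal{N}(0,1)^n$, and $$\left|\,\mathbb{E}_{X\sim\mu^n}[\psi(W^TX)]-\mathbb{E}_{Y\sim\mathcal{N}(0,1)^n}[\psi(W^TY)]\,\right|\le C\,\|\psi^{(4)}\|_1\,(\log k)^3\,\epsilon\log(1/\epsilon).$$ -/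

import Mathlib

open MeasureTheory ProbabilityTheory
open scoped ContDiff Matrix

/-- A distribution on `ℝ` is proper if, for `X ∼ μ`, the first three moments exist and
`E[X] = 0`, `E[X²] = 1`, `E[X³] = 0`. -/
structure IsProper (μ : Measure ℝ) : Prop where
  isProbabilityMeasure : IsProbabilityMeasure μ
  memLp_three : MemLp (fun x : ℝ => x) 3 μ
  moment_one : ∫ x, x ∂μ = 0
  moment_two : ∫ x, x ^ 2 ∂μ = 1
  moment_three : ∫ x, x ^ 3 ∂μ = 0

/-- A distribution on `ℝ` is hypercontractive if for some constant `c`, for all `m`, all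
`u ∈ ℝᵐ` and all real `q ≥ 2`, `‖⟨u, X⟩‖_q ≤ c √q ‖⟨u, X⟩‖_2` where `X ∼ μᵐ`.
The norms take values in `[0, ∞]`, so that nothing is said about a divergent moment by accident. -/
def IsHypercontractive (μ : Measure ℝ) : Prop :=
  ∃ c : ℝ, ∀ (m : ℕ) (u : Fin m → ℝ) (q : ℝ), 2 ≤ q →
    eLpNorm (fun x : Fin m → ℝ => u ⬝ᵥ x) (ENNReal.ofReal q) (Measure.pi fun _ => μ) ≤
      ENNReal.ofReal (c * √q) *
        eLpNorm (fun x : Fin m → ℝ => u ⬝ᵥ x) 2 (Measure.pi fun _ => μ)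

/-- A vector `u ∈ ℝⁿ` is `ε`-regular if `∑ uᵢ⁴ ≤ ε² ‖u‖²` (Euclidean norm). -/
def IsRegularVec {n : ℕ} (ε : ℝ) (u : Fin n → ℝ) : Prop :=
  ∑ i, u i ^ 4 ≤ ε ^ 2 * ‖WithLp.toLp 2 u‖ ^ 2

/-- A matrix is `ε`-regular if each of its columns is. -/
def IsRegularMatrix {n k : ℕ} (ε : ℝ) (W : Matrix (Fin n) (Fin k) ℝ) : Prop :=
  ∀ p, IsRegularVec ε (W.col p)

/-- The partial derivative `∂ₚ f`. -/
noncomputable def partialDeriv {k : ℕ} (p : Fin k) (f : (Fin k → ℝ) → ℝ) : (Fin k → ℝ) → ℝ :=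
  fun a => fderiv ℝ f a (Pi.single p 1)

/-- `‖ψ⁽⁴⁾‖₁ = sup_a ∑_{p,q,r,s} |∂ₚ∂_q∂_r∂ₛ ψ(a)|`, with values in `[0, ∞]`. -/
noncomputable def fourthDerivNorm {k : ℕ} (ψ : (Fin k → ℝ) → ℝ) : ENNReal :=
  ⨆ a : Fin k → ℝ, ENNReal.ofReal (∑ p, ∑ q, ∑ r, ∑ s,
    |partialDeriv p (partialDeriv q (partialDeriv r (partialDeriv s ψ))) a|)

/-
Colour the coordinates `1, …, n` at random with about `1 / (ε log k)` colours. Since the columns are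
`ε`-regular, `u i ^ 2 ≤ ε`, and an exponential-moment (Chernoff) estimate produces a colouring in
which the largest squared `ℓ²`-mass `M j` that a column puts on colour `j` satisfies
`∑ j, M j ^ 2 = O(ε log k)`. Pass from `μ^n` to `ν^n` by Lindeberg's method, one colour class at a
time. Expanding `ψ` to third order around the other classes, the Taylor polynomials integrate to the
same value because the first three moments of `μ` and `ν` agree, and the remainder is at most
`‖ψ⁽⁴⁾‖₁` times the expected fourth power of the maximum of `k` linear forms of variance at most
`M j`. Hypercontractivity with exponent `q ≈ log k` bounds this expectation by
`O((log k)² M j ^ 2)`, and summing over `j` gives `O(‖ψ⁽⁴⁾‖₁ (log k)³ ε)`. As `ε ≤ ε₀ < 1`,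
the factor `log (1 / ε)` is bounded below.
-/

section Colouring

variable {ι κ π : Type*} [Fintype ι] [DecidableEq κ]

/-- The total weight of the coordinates of colour `j` under the colouring `h`. -/
def colourMass (a : ι → ℝ) (h : ι → κ) (j : κ) : ℝ :=
  ∑ i with h i = j, a i

lemma colourMass_nonneg {a : ι → ℝ} (ha : ∀ i, 0 ≤ a i) (h : ι → κ) (j : κ) :
    0 ≤ colourMass a h j :=
  Finset.sum_nonneg fun i _ => ha i

lemma colourMass_le_sum {a : ι → ℝ} (ha : ∀ i, 0 ≤ a i) (h : ι → κ) (j : κ) :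
    colourMass a h j ≤ ∑ i, a i :=
  Finset.sum_le_sum_of_subset_of_nonneg (Finset.filter_subset _ _) fun i _ _ => ha i

lemma colourMass_div (a : ι → ℝ) (c : ℝ) (h : ι → κ) (j : κ) :
    colourMass (fun i => a i / c) h j = colourMass a h j / c := by
  simp only [colourMass, Finset.sum_div]

variable [Fintype κ] [Fintype π]

lemma sum_exp_colourMass [DecidableEq ι] (a : ι → ℝ) (j : κ) :
    ∑ h : ι → κ, Real.exp (colourMass a h j) =
      ∏ i, ((Fintype.card κ : ℝ) - 1 + Real.exp (a i)) := by
  have sum_one_coordinate : ∀ i, ∑ c : κ, Real.exp (if c = j then a i else 0) =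
      (Fintype.card κ : ℝ) - 1 + Real.exp (a i) := by
    intro i
    have hj : 1 ≤ Fintype.card κ := Fintype.card_pos_iff.2 ⟨j⟩
    simp [apply_ite Real.exp, Finset.sum_ite, Finset.filter_eq', Finset.filter_ne', add_comm,
      Nat.cast_sub hj]
  simp_rw [← sum_one_coordinate, Finset.prod_univ_sum, Fintype.piFinset_univ, ← Real.exp_sum,
    colourMass, Finset.sum_filter]

lemma exp_le_one_add_two_mul {x : ℝ} (h0 : 0 ≤ x) (h1 : x ≤ 1) : Real.exp x ≤ 1 + 2 * x := by
  have := (abs_le.1 (Real.abs_exp_sub_one_sub_id_le (abs_le.2 ⟨by linarith, h1⟩))).2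
  nlinarith

lemma sum_exp_colourMass_le [DecidableEq ι] {a : ι → ℝ} (h0 : ∀ i, 0 ≤ a i) (h1 : ∀ i, a i ≤ 1)
    (j : κ) :
    ∑ h : ι → κ, Real.exp (colourMass a h j) ≤
      (Fintype.card κ : ℝ) ^ Fintype.card ι * Real.exp (2 * (∑ i, a i) / Fintype.card κ) := by
  have hκ : 1 ≤ (Fintype.card κ : ℝ) := by exact_mod_cast Fintype.card_pos_iff.2 ⟨j⟩
  have factor_le : ∀ i, (Fintype.card κ : ℝ) - 1 + Real.exp (a i) ≤
      Fintype.card κ * Real.exp (2 * a i / Fintype.card κ) := fun i =>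
    calc (Fintype.card κ : ℝ) - 1 + Real.exp (a i)
        ≤ Fintype.card κ * (2 * a i / Fintype.card κ + 1) := by
          rw [mul_add, mul_div_cancel₀ _ (by positivity)]
          linarith [exp_le_one_add_two_mul (h0 i) (h1 i)]
      _ ≤ _ := by gcongr; exact Real.add_one_le_exp _
  calc ∑ h : ι → κ, Real.exp (colourMass a h j)
      = ∏ i, ((Fintype.card κ : ℝ) - 1 + Real.exp (a i)) := sum_exp_colourMass a j
    _ ≤ ∏ i, (Fintype.card κ * Real.exp (2 * a i / Fintype.card κ)) :=
        Finset.prod_le_prod (fun i _ => by linarith [Real.exp_pos (a i)]) fun i _ => factor_le i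
    _ = _ := by
        rw [Finset.prod_mul_distrib, ← Real.exp_sum, Finset.mul_sum, Finset.sum_div,
          Finset.prod_const, Finset.card_univ]

lemma exists_colouring_sum_exp_colourMass_le [Nonempty κ] {a : ι → π → ℝ} {s : ℝ}
    (h0 : ∀ i p, 0 ≤ a i p) (h1 : ∀ i p, a i p ≤ 1) (hs : ∀ p, ∑ i, a i p ≤ s) :
    ∃ h : ι → κ, ∑ j, ∑ p, Real.exp (colourMass (a · p) h j) ≤
      Fintype.card κ * (Fintype.card π * Real.exp (2 * s / Fintype.card κ)) := by
  classical
  suffices ∑ h : ι → κ, ∑ j, ∑ p, Real.exp (colourMass (a · p) h j) ≤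
      ∑ _h : ι → κ, Fintype.card κ * (Fintype.card π * Real.exp (2 * s / Fintype.card κ)) by
    obtain ⟨h, -, hh⟩ := Finset.exists_le_of_sum_le Finset.univ_nonempty this
    exact ⟨h, hh⟩
  calc ∑ h : ι → κ, ∑ j, ∑ p, Real.exp (colourMass (a · p) h j)
      = ∑ j : κ, ∑ p, ∑ h : ι → κ, Real.exp (colourMass (a · p) h j) := by
        rw [Finset.sum_comm]
        exact Finset.sum_congr rfl fun j _ => Finset.sum_comm
    _ ≤ ∑ _j : κ, ∑ _p : π,
          (Fintype.card κ : ℝ) ^ Fintype.card ι * Real.exp (2 * s / Fintype.card κ) := by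
        gcongr with j _ p _
        refine (sum_exp_colourMass_le (h0 · p) (h1 · p) j).trans ?_
        gcongr
        exact hs p
    _ = _ := by
        simp only [Finset.sum_const, Finset.card_univ, nsmul_eq_mul, Fintype.card_fun,
          Nat.cast_pow]
        ring

lemma sq_le_exp_sub {x L : ℝ} (hx : 0 ≤ x) (hL : 0 ≤ L) :
    x ^ 2 ≤ 2 * L ^ 2 + 4 * Real.exp (x - L) := by
  rcases le_total x L with h | h
  · nlinarith [Real.exp_pos (x - L)]
  · have := Real.quadratic_le_exp_of_nonneg (sub_nonneg.mpr h)
    nlinarith [sq_nonneg (x - 2 * L)]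

lemma exists_colouring_sum_sq_le [Nonempty κ] [Nonempty π] {a : ι → π → ℝ} {ε : ℝ} (hε : 0 < ε)
    (h0 : ∀ i p, 0 ≤ a i p) (h1 : ∀ i p, a i p ≤ ε) (hs : ∀ p, ∑ i, a i p ≤ 1) :
    ∃ (h : ι → κ) (M : κ → ℝ), (∀ j p, colourMass (a · p) h j ≤ M j) ∧
      ∑ j, M j ^ 2 ≤ ε ^ 2 * (Fintype.card κ *
        (2 * (Real.log (Fintype.card π) + 2 / (ε * Fintype.card κ)) ^ 2 + 4)) := by
  have hπ : 1 ≤ (Fintype.card π : ℝ) := by exact_mod_cast Fintype.card_pos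
  set L := Real.log (Fintype.card π) + 2 / (ε * Fintype.card κ) with hL
  have hL0 : 0 ≤ L := add_nonneg (Real.log_nonneg hπ) (by positivity)
  obtain ⟨h, hh⟩ := exists_colouring_sum_exp_colourMass_le (κ := κ) (a := fun i p => a i p / ε)
    (fun i p => div_nonneg (h0 i p) hε.le) (fun i p => (div_le_one hε).2 (h1 i p))
    (s := 1 / ε) (fun p => by rw [← Finset.sum_div]; gcongr; exact hs p)
  simp only [colourMass_div] at hh
  set S : κ → ℝ := fun j => ∑ p, Real.exp (colourMass (a · p) h j / ε)
  have exp_le : ∀ j p, Real.exp (colourMass (a · p) h j / ε) ≤ S j := fun j p =>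
    Finset.single_le_sum (f := fun p => Real.exp (colourMass (a · p) h j / ε))
      (fun _ _ => (Real.exp_pos _).le) (Finset.mem_univ p)
  have one_le : ∀ j, 1 ≤ S j := fun j =>
    (Real.one_le_exp (div_nonneg (colourMass_nonneg (h0 · _) h j) hε.le)).trans
      (exp_le j (Classical.arbitrary π))
  have S_pos : ∀ j, 0 < S j := fun j => one_pos.trans_le (one_le j)
  have sum_le : ∑ j, S j ≤ Fintype.card κ * Real.exp L := by
    refine hh.trans_eq ?_
    rw [hL, Real.exp_add, Real.exp_log (by positivity), mul_one_div, div_div]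
  have log_sq_le : ∀ j, Real.log (S j) ^ 2 ≤ 2 * L ^ 2 + 4 * (S j / Real.exp L) := fun j => by
    simpa only [Real.exp_sub, Real.exp_log (S_pos j)] using
      sq_le_exp_sub (Real.log_nonneg (one_le j)) hL0
  refine ⟨h, fun j => ε * Real.log (S j), fun j p => ?_, ?_⟩
  · rw [← div_le_iff₀' hε, Real.le_log_iff_exp_le (S_pos j)]
    exact exp_le j p
  · simp only [mul_pow, ← Finset.mul_sum]
    gcongr
    calc ∑ j, Real.log (S j) ^ 2 ≤ ∑ j, (2 * L ^ 2 + 4 * (S j / Real.exp L)) :=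
          Finset.sum_le_sum fun j _ => log_sq_le j
      _ = Fintype.card κ * (2 * L ^ 2) + 4 * ((∑ j, S j) / Real.exp L) := by
          rw [Finset.sum_add_distrib, Finset.sum_const, Finset.card_univ, nsmul_eq_mul,
            ← Finset.mul_sum, ← Finset.sum_div]
      _ ≤ Fintype.card κ * (2 * L ^ 2) + 4 * Fintype.card κ := by
          gcongr
          rwa [div_le_iff₀ (Real.exp_pos L)]
      _ = _ := by ring

lemma half_le_log_natCast {k : ℕ} (hk : 2 ≤ k) : 1 / 2 ≤ Real.log k := by
  have : Real.log 2 ≤ Real.log k := Real.log_le_log (by norm_num) (by exact_mod_cast hk)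
  linarith [Real.log_two_gt_d9]

lemma exists_balanced_colouring (hπ : 2 ≤ Fintype.card π) {a : ι → π → ℝ} {ε : ℝ} (hε : 0 < ε)
    (h0 : ∀ i p, 0 ≤ a i p) (h1 : ∀ i p, a i p ≤ ε) (hs : ∀ p, ∑ i, a i p ≤ 1) :
    ∃ (T : ℕ) (h : ι → Fin T) (M : Fin T → ℝ), (∀ j p, colourMass (a · p) h j ≤ M j) ∧
      ∑ j, M j ^ 2 ≤ 100 * (ε * Real.log (Fintype.card π)) := by
  have hlog := half_le_log_natCast hπ
  set l := Real.log (Fintype.card π)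
  have hεl : 0 < ε * l := by positivity
  rcases le_or_gt 1 (ε * l) with large | small
  · refine ⟨1, fun _ => 0, fun _ => 1, fun j p => ?_, ?_⟩
    · exact (colourMass_le_sum (h0 · p) _ j).trans (hs p)
    · simp only [Finset.univ_unique, Finset.sum_singleton]
      linarith
  have : Nonempty π := Fintype.card_pos_iff.1 (by omega)
  set T := ⌈1 / (ε * l)⌉₊
  have le_T : 1 ≤ T * (ε * l) := (div_le_iff₀ hεl).1 (Nat.le_ceil _)
  have T_le : T * (ε * l) ≤ 2 := by
    have : (T : ℝ) < 1 / (ε * l) + 1 := Nat.ceil_lt_add_one (by positivity)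
    rw [← sub_lt_iff_lt_add, lt_div_iff₀ hεl] at this
    linarith
  have T_pos : 0 < T := Nat.ceil_pos.2 (by positivity)
  have : Nonempty (Fin T) := Fin.pos_iff_nonempty.1 T_pos
  obtain ⟨h, M, hM, hM2⟩ := exists_colouring_sum_sq_le (κ := Fin T) hε h0 h1 hs
  refine ⟨T, h, M, hM, hM2.trans ?_⟩
  rw [Fintype.card_fin]
  have exponent_le : 2 / (ε * T) ≤ 2 * l := by
    rw [div_le_iff₀ (by positivity)]
    linarith
  calc ε ^ 2 * (T * (2 * (l + 2 / (ε * T)) ^ 2 + 4))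
      ≤ ε ^ 2 * (T * (2 * (l + 2 * l) ^ 2 + 16 * l ^ 2)) := by
        gcongr
        nlinarith
    _ = 34 * (ε * l) * (T * (ε * l)) := by ring
    _ ≤ 34 * (ε * l) * 2 := by gcongr
    _ ≤ _ := by linarith

end Colouring

section Taylor

open scoped Nat

variable {E F : Type*} [NormedAddCommGroup E] [NormedSpace ℝ E] [NormedAddCommGroup F]
  [NormedSpace ℝ F]

/-- The Taylor polynomial of degree `n` of `f` at `a`, as a function of the increment `u`. -/
noncomputable def taylorPolynomial (f : E → F) (n : ℕ) (a u : E) : F :=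
  ∑ m ∈ Finset.range (n + 1), (m ! : ℝ)⁻¹ • iteratedFDeriv ℝ m f a fun _ => u

lemma norm_sub_taylorPolynomial_le [CompleteSpace F] {f : E → F} {n : ℕ}
    (hf : ContDiff ℝ (n + 1) f) {B : ℝ} (hB : ∀ a, ‖iteratedFDeriv ℝ (n + 1) f a‖ ≤ B) (a u : E) :
    ‖f (a + u) - taylorPolynomial f n a u‖ ≤ B / (n + 1)! * ‖u‖ ^ (n + 1) := by
  rw [map_add_eq_sum_add_integral_iteratedFDeriv fun _ _ => hf.contDiffAt, taylorPolynomial,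
    add_sub_cancel_left, norm_smul, Real.norm_of_nonneg (by positivity)]
  have integrand_le : ∀ t ∈ Set.Ioc (0 : ℝ) 1,
      ‖(1 - t) ^ n • iteratedFDeriv ℝ (n + 1) f (a + t • u) fun _ => u‖ ≤
        (1 - t) ^ n * (B * ‖u‖ ^ (n + 1)) := by
    intro t ht
    rw [norm_smul, Real.norm_of_nonneg (pow_nonneg (sub_nonneg.2 ht.2) n)]
    refine mul_le_mul_of_nonneg_left ?_ (pow_nonneg (sub_nonneg.2 ht.2) n)
    refine ((iteratedFDeriv ℝ (n + 1) f (a + t • u)).le_opNorm fun _ => u).trans ?_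
    rw [Fin.prod_const]
    gcongr
    exact hB _
  have integral_one_sub_pow : ∫ t in (0 : ℝ)..1, (1 - t) ^ n = 1 / (n + 1) := by
    simp [intervalIntegral.integral_comp_sub_left (fun t => t ^ n)]
  calc (n ! : ℝ)⁻¹ * ‖∫ t in 0..1, (1 - t) ^ n • iteratedFDeriv ℝ (n + 1) f (a + t • u) fun _ => u‖
      ≤ (n ! : ℝ)⁻¹ * ∫ t in (0 : ℝ)..1, (1 - t) ^ n * (B * ‖u‖ ^ (n + 1)) := by
        gcongr
        exact intervalIntegral.norm_integral_le_of_norm_le zero_le_one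
          (.of_forall integrand_le) (Continuous.intervalIntegrable (by fun_prop) _ _)
    _ = _ := by
        rw [intervalIntegral.integral_mul_const, integral_one_sub_pow, Nat.factorial_succ]
        push_cast
        field_simp

end Taylor

section CoordinateExpansion

variable {κ F : Type*} [Fintype κ] [DecidableEq κ] [NormedAddCommGroup F] [NormedSpace ℝ F]

lemma multilinear_apply_eq_sum_single {E : Type*} [NormedAddCommGroup E] [NormedSpace ℝ E] {m : ℕ}
    (T : ContinuousMultilinearMap ℝ (fun _ : Fin m => E) F) (L : (κ → ℝ) →L[ℝ] E)
    (x : Fin m → κ → ℝ) :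
    T (fun j => L (x j)) =
      ∑ r : Fin m → κ, (∏ j, x j (r j)) • T fun j => L (Pi.single (r j) 1) := by
  conv_lhs => enter [2, j]; rw [pi_eq_sum_univ' (x j), map_sum]
  simp only [map_smul, T.map_sum, T.map_smul_univ]

lemma multilinear_opNorm_le_sum_single {m : ℕ}
    (T : ContinuousMultilinearMap ℝ (fun _ : Fin m => κ → ℝ) F) :
    ‖T‖ ≤ ∑ r : Fin m → κ, ‖T fun j => Pi.single (r j) 1‖ := by
  refine T.opNorm_le_bound (by positivity) fun x => ?_
  have expand := multilinear_apply_eq_sum_single T (.id ℝ _) x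
  simp only [ContinuousLinearMap.id_apply] at expand
  rw [expand, Finset.sum_mul]
  refine norm_sum_le_of_le _ fun r _ => ?_
  rw [norm_smul, norm_prod, mul_comm]
  gcongr with j
  exact norm_le_pi_norm (x j) (r j)

end CoordinateExpansion

section PartialDeriv

variable {k : ℕ}

lemma partialDeriv_iteratedFDeriv_apply {m : ℕ} {f : (Fin k → ℝ) → ℝ} (hf : ContDiff ℝ (m + 1) f)
    (p : Fin k) (w : Fin m → Fin k → ℝ) (a : Fin k → ℝ) :
    partialDeriv p (fun b => iteratedFDeriv ℝ m f b w) a =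
      iteratedFDeriv ℝ (m + 1) f a (Fin.cons (Pi.single p 1) w) := by
  rw [iteratedFDeriv_succ_apply_left, Fin.cons_zero, Fin.tail_cons, partialDeriv,
    fderiv_continuousMultilinear_apply_const_apply]
  exact (hf.differentiable_iteratedFDeriv (by exact_mod_cast m.lt_succ_self)).differentiableAt

lemma iterate_four_partialDeriv {ψ : (Fin k → ℝ) → ℝ} (hψ : ContDiff ℝ 4 ψ) (p q r s : Fin k)
    (a : Fin k → ℝ) :
    partialDeriv p (partialDeriv q (partialDeriv r (partialDeriv s ψ))) a =
      iteratedFDeriv ℝ 4 ψ a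
        ![Pi.single p 1, Pi.single q 1, Pi.single r 1, Pi.single s 1] := by
  have partialDeriv_apply {m : ℕ} (hm : m < 4) (p : Fin k) (w : Fin m → Fin k → ℝ) :
      partialDeriv p (fun b => iteratedFDeriv ℝ m ψ b w) =
        fun b => iteratedFDeriv ℝ (m + 1) ψ b (Matrix.vecCons (Pi.single p 1) w) :=
    funext <| partialDeriv_iteratedFDeriv_apply (hψ.of_le (by exact_mod_cast hm)) p w
  have eq_zeroth : ψ = fun b => iteratedFDeriv ℝ 0 ψ b ![] :=
    funext fun b => (iteratedFDeriv_zero_apply _).symm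
  conv_lhs => rw [eq_zeroth]
  iterate 4 rw [partialDeriv_apply (by norm_num)]

lemma sum_fin_succ_arrow {κ M : Type*} [Fintype κ] [AddCommMonoid M] {m : ℕ}
    (f : (Fin (m + 1) → κ) → M) :
    ∑ r, f r = ∑ p, ∑ r, f (Matrix.vecCons p r) := by
  rw [← (Fin.consEquiv fun _ => κ).sum_comp f, Fintype.sum_prod_type]
  rfl

lemma sum_abs_partialDeriv {ψ : (Fin k → ℝ) → ℝ} (hψ : ContDiff ℝ 4 ψ) (a : Fin k → ℝ) :
    ∑ p, ∑ q, ∑ r, ∑ s, |partialDeriv p (partialDeriv q (partialDeriv r (partialDeriv s ψ))) a| =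
      ∑ r : Fin 4 → Fin k, ‖iteratedFDeriv ℝ 4 ψ a fun j => Pi.single (r j) 1‖ := by
  simp only [sum_fin_succ_arrow, Fintype.sum_unique, iterate_four_partialDeriv hψ,
    Real.norm_eq_abs]
  refine Finset.sum_congr rfl fun p _ => Finset.sum_congr rfl fun q _ =>
    Finset.sum_congr rfl fun r _ => Finset.sum_congr rfl fun s _ => ?_
  congr 2
  ext j : 1
  fin_cases j <;> rfl

lemma norm_iteratedFDeriv_four_le_fourthDerivNorm {ψ : (Fin k → ℝ) → ℝ} (hψ : ContDiff ℝ 4 ψ)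
    (hfin : fourthDerivNorm ψ < ⊤) (a : Fin k → ℝ) :
    ‖iteratedFDeriv ℝ 4 ψ a‖ ≤ (fourthDerivNorm ψ).toReal := by
  refine (multilinear_opNorm_le_sum_single _).trans ?_
  rw [← sum_abs_partialDeriv hψ, ← ENNReal.ofReal_le_iff_le_toReal hfin.ne]
  exact le_iSup (fun a => ENNReal.ofReal (∑ p, ∑ q, ∑ r, ∑ s,
    |partialDeriv p (partialDeriv q (partialDeriv r (partialDeriv s ψ))) a|)) a

end PartialDeriv

section ProductMeasures

lemma memLp_id_piecewise {ι : Type*} {μ ν : ι → Measure ℝ} {p : ENNReal} (s : Set ι)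
    [DecidablePred (· ∈ s)] (hμ : ∀ i, MemLp id p (μ i)) (hν : ∀ i, MemLp id p (ν i)) (i : ι) :
    MemLp id p (s.piecewise μ ν i) := by
  by_cases hi : i ∈ s <;> simp only [Set.piecewise, hi, if_true, if_false, hμ, hν]

variable {ι κ : Type*} [Fintype ι] {μ ν : ι → Measure ℝ} [∀ i, IsProbabilityMeasure (μ i)]
  [∀ i, IsProbabilityMeasure (ν i)]

lemma memLp_id_pi {p : ENNReal} (hμ : ∀ i, MemLp id p (μ i)) : MemLp id p (Measure.pi μ) :=
  memLp_pi_iff.2 fun i => (hμ i).comp_measurePreserving (measurePreserving_eval μ i)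

lemma integrable_pow_of_memLp {ρ : Measure ℝ} [IsFiniteMeasure ρ] {n e : ℕ}
    (hρ : MemLp id n ρ) (he : e ≤ n) : Integrable (fun x => x ^ e) ρ :=
  (integrable_norm_iff (by fun_prop)).1 <| by
    simpa only [norm_pow, id] using (hρ.mono_exponent (by exact_mod_cast he)).integrable_norm_pow'

lemma prod_comp_eq_prod_pow {M : Type*} [CommMonoid M] [Fintype κ] [DecidableEq ι] (r : κ → ι)
    (x : ι → M) : ∏ j, x (r j) = ∏ i, x i ^ (Finset.univ.filter (r · = i)).card := by
  simp only [← Finset.prod_const, Finset.prod_fiberwise']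

lemma card_filter_fin_le {m : ℕ} (p : Fin m → Prop) [DecidablePred p] :
    (Finset.univ.filter p).card ≤ m :=
  (Finset.card_filter_le _ _).trans (Finset.card_fin m).le

lemma integrable_monomial {m n : ℕ} (hm : m ≤ n) (hμ : ∀ i, MemLp id n (μ i)) (r : Fin m → ι) :
    Integrable (fun x => ∏ j, x (r j)) (Measure.pi μ) := by
  classical
  simp only [prod_comp_eq_prod_pow]
  exact Integrable.fintype_prod (f := fun i (y : ℝ) => y ^ _) fun i =>
    integrable_pow_of_memLp (hμ i) ((card_filter_fin_le _).trans hm)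

/-- Two laws on `ℝ` have the same moments up to order `d`; their existence is assumed separately. -/
def HaveEqualMoments (d : ℕ) (μ ν : Measure ℝ) : Prop :=
  ∀ m ≤ d, ∫ x, x ^ m ∂μ = ∫ x, x ^ m ∂ν

lemma integral_monomial_eq {m d : ℕ} (hm : m ≤ d) (h : ∀ i, HaveEqualMoments d (μ i) (ν i))
    (r : Fin m → ι) :
    ∫ x, ∏ j, x (r j) ∂(Measure.pi μ) = ∫ x, ∏ j, x (r j) ∂(Measure.pi ν) := by
  classical
  simp only [prod_comp_eq_prod_pow]
  rw [integral_fintype_prod_eq_prod (fun i (y : ℝ) => y ^ _),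
    integral_fintype_prod_eq_prod (fun i (y : ℝ) => y ^ _)]
  exact Finset.prod_congr rfl fun i _ => h i _ ((card_filter_fin_le _).trans hm)

instance isProbabilityMeasure_piecewise (s : Set ι) [DecidablePred (· ∈ s)] (i : ι) :
    IsProbabilityMeasure (s.piecewise μ ν i) := by
  unfold Set.piecewise
  split_ifs <;> infer_instance

lemma measurePreserving_piecewise (s : Set ι) [DecidablePred (· ∈ s)] (μ ν : ι → Measure ℝ)
    [∀ i, IsProbabilityMeasure (μ i)] [∀ i, IsProbabilityMeasure (ν i)] :
    MeasurePreserving (fun z : (ι → ℝ) × (ι → ℝ) => s.piecewise z.1 z.2)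
      ((Measure.pi μ).prod (Measure.pi ν)) (Measure.pi (s.piecewise μ ν)) := by
  have select : ∀ i, MeasurePreserving (fun z : ℝ × ℝ => if i ∈ s then z.1 else z.2)
      ((μ i).prod (ν i)) (s.piecewise μ ν i) := fun i => by
    unfold Set.piecewise
    split_ifs
    exacts [measurePreserving_fst, measurePreserving_snd]
  exact (measurePreserving_pi _ _ select).comp
    (measurePreserving_arrowProdEquivProdArrow ℝ ℝ ι μ ν).symm

lemma integral_piecewise {F : Type*} [NormedAddCommGroup F] [NormedSpace ℝ F] (s : Set ι)
    [DecidablePred (· ∈ s)] {g : (ι → ℝ) → F}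
    (hg : Integrable g (Measure.pi (s.piecewise μ ν))) :
    Integrable (fun y => ∫ x, g (sᶜ.indicator y + s.indicator x) ∂(Measure.pi μ)) (Measure.pi ν) ∧
    ∫ x, g x ∂(Measure.pi (s.piecewise μ ν)) =
      ∫ y, ∫ x, g (sᶜ.indicator y + s.indicator x) ∂(Measure.pi μ) ∂(Measure.pi ν) := by
  have select := measurePreserving_piecewise s μ ν
  have joint := select.integrable_comp_of_integrable hg
  have eq_add (z : (ι → ℝ) × (ι → ℝ)) :
      g (s.piecewise z.1 z.2) = g (sᶜ.indicator z.2 + s.indicator z.1) := by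
    rw [add_comm, Set.indicator_add_compl_eq_piecewise]
  simp only [Function.comp_def, eq_add] at joint
  refine ⟨joint.integral_prod_right, ?_⟩
  rw [← integral_prod_symm _ joint, ← select.map_eq, integral_map select.aemeasurable]
  · simp only [eq_add]
  · rw [select.map_eq]
    exact hg.aestronglyMeasurable

end ProductMeasures

section Lindeberg

variable {ι E F : Type*} [Fintype ι] [NormedAddCommGroup E] [NormedSpace ℝ E]
  [NormedAddCommGroup F] [NormedSpace ℝ F]
  {μ ν : ι → Measure ℝ} [∀ i, IsProbabilityMeasure (μ i)] [∀ i, IsProbabilityMeasure (ν i)] {d : ℕ}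

lemma integrable_multilinear_comp {m n : ℕ} (hm : m ≤ n) (hμ : ∀ i, MemLp id n (μ i))
    (T : ContinuousMultilinearMap ℝ (fun _ : Fin m => E) F) (L : (ι → ℝ) →L[ℝ] E) :
    Integrable (fun x => T fun _ => L x) (Measure.pi μ) := by
  classical
  simp only [fun x => multilinear_apply_eq_sum_single T L fun _ => x]
  exact integrable_finsetSum _ fun r _ => (integrable_monomial hm hμ r).smul_const _

lemma integrable_taylorPolynomial_comp (hμ : ∀ i, MemLp id d (μ i)) (f : E → F) (v : E)
    (L : (ι → ℝ) →L[ℝ] E) :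
    Integrable (fun x => taylorPolynomial f d v (L x)) (Measure.pi μ) :=
  integrable_finsetSum _ fun _ hm =>
    (integrable_multilinear_comp (Finset.mem_range_succ_iff.1 hm) hμ _ L).smul _

lemma integrable_norm_pow_comp (hμ : ∀ i, MemLp id d (μ i)) (L : (ι → ℝ) →L[ℝ] E) :
    Integrable (fun x => ‖L x‖ ^ d) (Measure.pi μ) :=
  (L.comp_memLp' (memLp_id_pi hμ)).integrable_norm_pow'

variable [CompleteSpace F] {f : E → F} {B : ℝ}

lemma integral_multilinear_comp_eq {m n : ℕ} (hm : m ≤ n) (hμ : ∀ i, MemLp id n (μ i))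
    (hν : ∀ i, MemLp id n (ν i)) (h : ∀ i, HaveEqualMoments n (μ i) (ν i))
    (T : ContinuousMultilinearMap ℝ (fun _ : Fin m => E) F) (L : (ι → ℝ) →L[ℝ] E) :
    ∫ x, T (fun _ => L x) ∂(Measure.pi μ) = ∫ x, T (fun _ => L x) ∂(Measure.pi ν) := by
  classical
  have expand x := multilinear_apply_eq_sum_single T L fun _ => x
  simp only [expand]
  rw [integral_finsetSum _ fun r _ => (integrable_monomial hm hμ r).smul_const _,
    integral_finsetSum _ fun r _ => (integrable_monomial hm hν r).smul_const _]
  exact Finset.sum_congr rfl fun r _ => by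
    rw [integral_smul_const, integral_smul_const, integral_monomial_eq hm h]

lemma integral_taylorPolynomial_comp_eq (hμ : ∀ i, MemLp id d (μ i)) (hν : ∀ i, MemLp id d (ν i))
    (h : ∀ i, HaveEqualMoments d (μ i) (ν i)) (f : E → F) (v : E) (L : (ι → ℝ) →L[ℝ] E) :
    ∫ x, taylorPolynomial f d v (L x) ∂(Measure.pi μ) =
      ∫ x, taylorPolynomial f d v (L x) ∂(Measure.pi ν) := by
  have order_le {m : ℕ} (hm : m ∈ Finset.range (d + 1)) : m ≤ d := Finset.mem_range_succ_iff.1 hm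
  simp only [taylorPolynomial]
  rw [integral_finsetSum _ fun m hm =>
      (integrable_multilinear_comp (order_le hm) hμ _ L).fun_smul _,
    integral_finsetSum _ fun m hm =>
      (integrable_multilinear_comp (order_le hm) hν _ L).fun_smul _]
  refine Finset.sum_congr rfl fun m hm => ?_
  rw [integral_smul, integral_smul, integral_multilinear_comp_eq (order_le hm) hμ hν h]

lemma integrable_sub_taylorPolynomial_comp (hμ : ∀ i, MemLp id (d + 1 : ℕ) (μ i))
    (hf : ContDiff ℝ (d + 1) f) (hB : ∀ a, ‖iteratedFDeriv ℝ (d + 1) f a‖ ≤ B) (v : E)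
    (L : (ι → ℝ) →L[ℝ] E) :
    Integrable (fun x => f (v + L x) - taylorPolynomial f d v (L x)) (Measure.pi μ) := by
  have continuous_comp : Continuous fun x => f (v + L x) := hf.continuous.comp (by fun_prop)
  have poly := integrable_taylorPolynomial_comp
    (fun i => (hμ i).mono_exponent (by exact_mod_cast d.le_succ)) f v L
  exact ((integrable_norm_pow_comp hμ L).const_mul _).mono'
    (continuous_comp.aestronglyMeasurable.sub poly.aestronglyMeasurable)
    (.of_forall fun x => norm_sub_taylorPolynomial_le hf hB v (L x))

lemma integrable_comp_add (hμ : ∀ i, MemLp id (d + 1 : ℕ) (μ i)) (hf : ContDiff ℝ (d + 1) f)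
    (hB : ∀ a, ‖iteratedFDeriv ℝ (d + 1) f a‖ ≤ B) (v : E) (L : (ι → ℝ) →L[ℝ] E) :
    Integrable (fun x => f (v + L x)) (Measure.pi μ) :=
  ((integrable_sub_taylorPolynomial_comp hμ hf hB v L).add
    (integrable_taylorPolynomial_comp
      (fun i => (hμ i).mono_exponent (by exact_mod_cast d.le_succ)) f v L)).congr
    (.of_forall fun x => sub_add_cancel _ _)

lemma norm_integral_comp_add_sub_le (hμ : ∀ i, MemLp id (d + 1 : ℕ) (μ i))
    (hν : ∀ i, MemLp id (d + 1 : ℕ) (ν i)) (h : ∀ i, HaveEqualMoments d (μ i) (ν i))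
    (hf : ContDiff ℝ (d + 1) f) (hB : ∀ a, ‖iteratedFDeriv ℝ (d + 1) f a‖ ≤ B) (v : E)
    (L : (ι → ℝ) →L[ℝ] E) :
    ‖∫ x, f (v + L x) ∂(Measure.pi μ) - ∫ x, f (v + L x) ∂(Measure.pi ν)‖ ≤
      B / (d + 1).factorial *
        (∫ x, ‖L x‖ ^ (d + 1) ∂(Measure.pi μ) + ∫ x, ‖L x‖ ^ (d + 1) ∂(Measure.pi ν)) := by
  have hμd i : MemLp id d (μ i) := (hμ i).mono_exponent (by exact_mod_cast d.le_succ)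
  have hνd i : MemLp id d (ν i) := (hν i).mono_exponent (by exact_mod_cast d.le_succ)
  have remainder_le {ρ : ι → Measure ℝ} [∀ i, IsProbabilityMeasure (ρ i)]
      (hρ : ∀ i, MemLp id (d + 1 : ℕ) (ρ i)) :
      ‖∫ x, f (v + L x) - taylorPolynomial f d v (L x) ∂(Measure.pi ρ)‖ ≤
        B / (d + 1).factorial * ∫ x, ‖L x‖ ^ (d + 1) ∂(Measure.pi ρ) := by
    rw [← integral_const_mul]
    exact norm_integral_le_of_norm_le ((integrable_norm_pow_comp hρ L).const_mul _)
      (.of_forall fun x => norm_sub_taylorPolynomial_le hf hB v (L x))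
  calc ‖∫ x, f (v + L x) ∂(Measure.pi μ) - ∫ x, f (v + L x) ∂(Measure.pi ν)‖
      = ‖∫ x, f (v + L x) - taylorPolynomial f d v (L x) ∂(Measure.pi μ) -
          ∫ x, f (v + L x) - taylorPolynomial f d v (L x) ∂(Measure.pi ν)‖ := by
        rw [integral_sub (integrable_comp_add hμ hf hB v L)
            (integrable_taylorPolynomial_comp hμd f v L),
          integral_sub (integrable_comp_add hν hf hB v L)
            (integrable_taylorPolynomial_comp hνd f v L),
          integral_taylorPolynomial_comp_eq hμd hνd h f v L, sub_sub_sub_cancel_right]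
    _ ≤ _ := by
        rw [mul_add]
        exact (norm_sub_le _ _).trans (add_le_add (remainder_le hμ) (remainder_le hν))

/-- The projection of `ℝ^ι` onto the coordinates in `s`. -/
noncomputable def indicatorCLM (s : Set ι) : (ι → ℝ) →L[ℝ] ι → ℝ :=
  LinearMap.toContinuousLinearMap
    { toFun := s.indicator
      map_add' := s.indicator_add
      map_smul' := fun c x => s.indicator_const_smul c x }

lemma norm_integral_piecewise_sub_le {ρ : ι → Measure ℝ} [∀ i, IsProbabilityMeasure (ρ i)]
    (s : Set ι) [DecidablePred (· ∈ s)] (hμ : ∀ i, MemLp id (d + 1 : ℕ) (μ i))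
    (hν : ∀ i, MemLp id (d + 1 : ℕ) (ν i)) (hρ : ∀ i, MemLp id (d + 1 : ℕ) (ρ i))
    (h : ∀ i, HaveEqualMoments d (μ i) (ν i)) (hf : ContDiff ℝ (d + 1) f)
    (hB : ∀ a, ‖iteratedFDeriv ℝ (d + 1) f a‖ ≤ B) (L : (ι → ℝ) →L[ℝ] E) :
    ‖∫ x, f (L x) ∂(Measure.pi (s.piecewise μ ρ)) -
        ∫ x, f (L x) ∂(Measure.pi (s.piecewise ν ρ))‖ ≤
      B / (d + 1).factorial * (∫ x, ‖L (s.indicator x)‖ ^ (d + 1) ∂(Measure.pi μ) +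
        ∫ x, ‖L (s.indicator x)‖ ^ (d + 1) ∂(Measure.pi ν)) := by
  have integrable_hybrid {τ : ι → Measure ℝ} [∀ i, IsProbabilityMeasure (τ i)]
      (hτ : ∀ i, MemLp id (d + 1 : ℕ) (τ i)) :
      Integrable (fun x => f (L x)) (Measure.pi (s.piecewise τ ρ)) := by
    simpa only [zero_add] using integrable_comp_add (memLp_id_piecewise s hτ hρ) hf hB 0 L
  obtain ⟨integrable_μ, eq_μ⟩ := integral_piecewise s (integrable_hybrid hμ)
  obtain ⟨integrable_ν, eq_ν⟩ := integral_piecewise s (integrable_hybrid hν)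
  rw [eq_μ, eq_ν, ← integral_sub integrable_μ integrable_ν]
  refine (norm_integral_le_of_norm_le (integrable_const _) (.of_forall fun y => ?_)).trans_eq
    ((integral_const _).trans (by rw [probReal_univ, one_smul]))
  simp only [map_add]
  exact norm_integral_comp_add_sub_le hμ hν h hf hB (L (sᶜ.indicator y)) (L.comp (indicatorCLM s))

lemma norm_integral_comp_sub_le_sum {κ : Type*} [Fintype κ] (c : ι → κ)
    (hμ : ∀ i, MemLp id (d + 1 : ℕ) (μ i)) (hν : ∀ i, MemLp id (d + 1 : ℕ) (ν i))
    (h : ∀ i, HaveEqualMoments d (μ i) (ν i)) (hf : ContDiff ℝ (d + 1) f)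
    (hB : ∀ a, ‖iteratedFDeriv ℝ (d + 1) f a‖ ≤ B) (L : (ι → ℝ) →L[ℝ] E) :
    ‖∫ x, f (L x) ∂(Measure.pi μ) - ∫ x, f (L x) ∂(Measure.pi ν)‖ ≤
      ∑ j, B / (d + 1).factorial *
        (∫ x, ‖L ({i | c i = j}.indicator x)‖ ^ (d + 1) ∂(Measure.pi μ) +
          ∫ x, ‖L ({i | c i = j}.indicator x)‖ ^ (d + 1) ∂(Measure.pi ν)) := by
  classical
  let hybrid (S : Finset κ) : ι → Measure ℝ := {i | c i ∈ S}.piecewise ν μ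
  suffices hybrid_bound : ∀ S : Finset κ,
      ‖∫ x, f (L x) ∂(Measure.pi μ) - ∫ x, f (L x) ∂(Measure.pi (hybrid S))‖ ≤
        ∑ j ∈ S, B / (d + 1).factorial *
          (∫ x, ‖L ({i | c i = j}.indicator x)‖ ^ (d + 1) ∂(Measure.pi μ) +
            ∫ x, ‖L ({i | c i = j}.indicator x)‖ ^ (d + 1) ∂(Measure.pi ν)) by
    have hybrid_univ : hybrid Finset.univ = ν := by ext1 i; simp [hybrid]
    simpa only [hybrid_univ] using hybrid_bound Finset.univ
  intro S
  induction S using Finset.induction_on with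
  | empty =>
    have hybrid_empty : hybrid ∅ = μ := by ext1 i; simp [hybrid]
    simp [hybrid_empty]
  | insert j S hj ih =>
    have before : hybrid S = {i | c i = j}.piecewise μ (hybrid S) := by
      ext1 i
      by_cases hi : c i = j <;> simp [hybrid, Set.piecewise, hi, hj]
    have after : hybrid (insert j S) = {i | c i = j}.piecewise ν (hybrid S) := by
      ext1 i
      by_cases hi : c i = j <;> simp [hybrid, Set.piecewise, hi]
    have replace_block := norm_integral_piecewise_sub_le {i | c i = j} hμ hν
      (memLp_id_piecewise {i | c i ∈ S} hν hμ) h hf hB L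
    rw [Finset.sum_insert hj, add_comm]
    refine (norm_sub_le_norm_sub_add_norm_sub _ _ _).trans (add_le_add ih ?_)
    rw [after]
    nth_rw 1 [before]
    exact replace_block

end Lindeberg

section MomentBounds

variable {Ω E π : Type*} [MeasurableSpace Ω] {P : Measure Ω} [NormedAddCommGroup E] [Fintype π]

lemma eLpNorm_ofReal_le_ofReal_iff {f : Ω → E} {q B : ℝ} (hq : 0 < q) (hB : 0 ≤ B) :
    eLpNorm f (ENNReal.ofReal q) P ≤ ENNReal.ofReal B ↔
      ∫⁻ x, ‖f x‖ₑ ^ q ∂P ≤ ENNReal.ofReal (B ^ q) := by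
  rw [eLpNorm_eq_lintegral_rpow_enorm_toReal (by simpa using hq) ENNReal.ofReal_ne_top,
    ENNReal.toReal_ofReal hq.le, one_div, ENNReal.rpow_inv_le_iff hq,
    ENNReal.ofReal_rpow_of_nonneg hB hq.le]

lemma integral_norm_pow_le_of_eLpNorm_le {f : Ω → E} {n : ℕ} {B : ℝ} (hn : n ≠ 0) (hB : 0 ≤ B)
    (hf : AEStronglyMeasurable f P) (h : eLpNorm f n P ≤ ENNReal.ofReal B) :
    ∫ x, ‖f x‖ ^ n ∂P ≤ B ^ n := by
  rw [← ENNReal.ofReal_natCast, eLpNorm_ofReal_le_ofReal_iff (by positivity) hB] at h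
  simp only [ENNReal.rpow_natCast, Real.rpow_natCast] at h
  rw [integral_eq_lintegral_of_nonneg_ae (.of_forall fun x => by positivity) (hf.norm.fun_pow n)]
  refine ENNReal.toReal_le_of_le_ofReal (by positivity) (le_of_eq_of_le ?_ h)
  simp only [ENNReal.ofReal_pow (norm_nonneg _), ofReal_norm]

lemma enorm_rpow_le_sum (v : π → E) {q : ℝ} (hq : 0 < q) : ‖v‖ₑ ^ q ≤ ∑ p, ‖v p‖ₑ ^ q := by
  rcases isEmpty_or_nonempty π with _ | _
  · simp [Subsingleton.elim v 0, hq]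
  obtain ⟨p, -, hp⟩ := Finset.exists_mem_eq_sup' Finset.univ_nonempty fun p => ‖v p‖₊
  have enorm_eq : ‖v‖ₑ = ‖v p‖ₑ := by
    rw [enorm_eq_nnnorm, Pi.nnnorm_def, ← Finset.sup'_eq_sup Finset.univ_nonempty, hp,
      enorm_eq_nnnorm]
  rw [enorm_eq]
  exact Finset.single_le_sum (f := fun p => ‖v p‖ₑ ^ q) (fun _ _ => zero_le) (Finset.mem_univ p)

lemma eLpNorm_pi_le {f : Ω → π → E} {q B : ℝ} (hq : 0 < q) (hB : 0 ≤ B)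
    (hf : ∀ p, AEStronglyMeasurable (fun x => f x p) P)
    (h : ∀ p, eLpNorm (fun x => f x p) (ENNReal.ofReal q) P ≤ ENNReal.ofReal B) :
    eLpNorm f (ENNReal.ofReal q) P ≤ ENNReal.ofReal (Fintype.card π ^ (1 / q) * B) := by
  simp only [eLpNorm_ofReal_le_ofReal_iff hq hB] at h
  rw [eLpNorm_ofReal_le_ofReal_iff hq (by positivity)]
  calc ∫⁻ x, ‖f x‖ₑ ^ q ∂P ≤ ∫⁻ x, ∑ p, ‖f x p‖ₑ ^ q ∂P :=
        lintegral_mono fun x => enorm_rpow_le_sum (f x) hq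
    _ = ∑ p, ∫⁻ x, ‖f x p‖ₑ ^ q ∂P :=
        lintegral_finsetSum' _ fun p _ => (hf p).enorm.pow_const q
    _ ≤ ∑ _p : π, ENNReal.ofReal (B ^ q) := Finset.sum_le_sum fun p _ => h p
    _ = ENNReal.ofReal ((Fintype.card π ^ (1 / q) * B) ^ q) := by
        rw [Real.mul_rpow (by positivity) hB, ← Real.rpow_mul (by positivity),
          one_div_mul_cancel hq.ne', Real.rpow_one, ENNReal.ofReal_mul (by positivity)]
        simp

lemma natCast_rpow_one_div_le_exp_one {k : ℕ} {q : ℝ} (hk : 0 < k) (hq : 0 < q)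
    (hkq : Real.log k ≤ q) : (k : ℝ) ^ (1 / q) ≤ Real.exp 1 := by
  rw [Real.rpow_def_of_pos (by positivity), mul_one_div]
  exact Real.exp_le_exp.2 ((div_le_one hq).2 hkq)

end MomentBounds

section SubGaussian

variable {Ω ι : Type*} [MeasurableSpace Ω] {P : Measure Ω} [Fintype ι]

lemma two_mul_exp_half_le_four_rpow {q : ℝ} (hq : 1 ≤ q) : 2 * Real.exp (q / 2) ≤ 4 ^ q := by
  have two_le : (2 : ℝ) ≤ 2 ^ q := by
    simpa using Real.rpow_le_rpow_of_exponent_le (x := 2) one_le_two hq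
  have exp_le : Real.exp (q / 2) ≤ 2 ^ q := by
    rw [show q / 2 = 1 / 2 * q by ring, Real.exp_mul]
    gcongr
    have := exp_le_one_add_two_mul (x := 1 / 2) (by norm_num) (by norm_num)
    linarith
  calc 2 * Real.exp (q / 2) ≤ 2 ^ q * 2 ^ q := by gcongr
    _ = 4 ^ q := by rw [← Real.mul_rpow zero_le_two zero_le_two]; norm_num

lemma lintegral_enorm_rpow_le_of_hasSubgaussianMGF {X : Ω → ℝ} {v : NNReal}
    (h : HasSubgaussianMGF X v P) {q t : ℝ} (hq : 0 ≤ q) (ht : 0 < t) :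
    ∫⁻ x, ‖X x‖ₑ ^ q ∂P ≤ ENNReal.ofReal ((q / t) ^ q * (2 * Real.exp (v * t ^ 2 / 2))) := by
  have integrable_exp := (h.integrable_exp_mul t).fun_add (h.integrable_exp_mul (-t))
  calc ∫⁻ x, ‖X x‖ₑ ^ q ∂P
      ≤ ∫⁻ x, ENNReal.ofReal ((q / t) ^ q * (Real.exp (t * X x) + Real.exp (-t * X x))) ∂P := by
        refine lintegral_mono fun x => ?_
        rw [← ofReal_norm, ENNReal.ofReal_rpow_of_nonneg (norm_nonneg _) hq]
        refine ENNReal.ofReal_le_ofReal ((rpow_abs_le_mul_max_exp_of_pos (X x) hq ht).trans ?_)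
        gcongr
        exact max_le_add_of_nonneg (Real.exp_pos _).le (Real.exp_pos _).le
    _ = ENNReal.ofReal ((q / t) ^ q * (mgf X P t + mgf X P (-t))) := by
        rw [← ofReal_integral_eq_lintegral_ofReal (integrable_exp.const_mul _)
          (.of_forall fun x => by positivity), integral_const_mul,
          integral_add (h.integrable_exp_mul t) (h.integrable_exp_mul (-t)), mgf, mgf]
    _ ≤ _ := by
        gcongr
        linarith [h.mgf_le t, neg_sq t ▸ h.mgf_le (-t)]

lemma eLpNorm_le_of_hasSubgaussianMGF {X : Ω → ℝ} {v : NNReal} (h : HasSubgaussianMGF X v P)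
    {q : ℝ} (hq : 1 ≤ q) :
    eLpNorm X (ENNReal.ofReal q) P ≤ ENNReal.ofReal (4 * √q * √v) := by
  have q_pos : 0 < q := by linarith
  rcases eq_or_ne v 0 with rfl | hv
  · simp [eLpNorm_congr_ae h.ae_eq_zero_of_hasSubgaussianMGF_zero]
  have v_pos : 0 < (v : ℝ) := by positivity
  -- the choice of `t` balancing `(q / t) ^ q` against `exp (v * t ^ 2 / 2)`
  have bound := lintegral_enorm_rpow_le_of_hasSubgaussianMGF h q_pos.le
    (div_pos (Real.sqrt_pos.2 q_pos) (Real.sqrt_pos.2 v_pos))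
  rw [eLpNorm_ofReal_le_ofReal_iff q_pos (by positivity)]
  refine bound.trans (ENNReal.ofReal_le_ofReal ?_)
  have scale_eq : q / (√q / √v) = √q * √v := by
    rw [div_div_eq_mul_div, mul_div_right_comm, Real.div_sqrt]
  have exponent_eq : v * (√q / √v) ^ 2 / 2 = q / 2 := by
    rw [div_pow, Real.sq_sqrt q_pos.le, Real.sq_sqrt v_pos.le, mul_div_cancel₀ _ v_pos.ne']
  rw [scale_eq, exponent_eq, mul_assoc, Real.mul_rpow (x := 4) (by norm_num) (by positivity),
    mul_comm]
  gcongr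
  exact two_mul_exp_half_le_four_rpow hq

lemma hasSubgaussianMGF_dotProduct {μ : Measure ℝ} [IsProbabilityMeasure μ] {v : NNReal}
    (h : HasSubgaussianMGF id v μ) (u : ι → ℝ) :
    HasSubgaussianMGF (fun x => u ⬝ᵥ x) (∑ i, ‖u i‖₊ ^ 2 * v) (Measure.pi fun _ => μ) := by
  have term (i : ι) :
      HasSubgaussianMGF (fun x => u i * x i) (‖u i‖₊ ^ 2 * v) (Measure.pi fun _ => μ) := by
    have eval : HasSubgaussianMGF (fun x => x i) v (Measure.pi fun _ : ι => μ) :=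
      (HasSubgaussianMGF.id_map_iff (measurable_pi_apply i).aemeasurable).1
        ((measurePreserving_eval (fun _ : ι => μ) i).map_eq.symm ▸ h)
    have parameter_eq : ‖u i‖₊ ^ 2 = ⟨u i ^ 2, sq_nonneg (u i)⟩ := NNReal.eq (sq_abs (u i))
    rw [parameter_eq]
    exact eval.const_mul (u i)
  exact HasSubgaussianMGF.sum_of_iIndepFun
    (iIndepFun_pi (X := fun i x => u i * x) fun i => by fun_prop) fun i _ => term i

lemma hasSubgaussianMGF_id_gaussianReal : HasSubgaussianMGF id 1 (gaussianReal 0 1) where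
  integrable_exp_mul := integrable_exp_mul_gaussianReal
  mgf_le t := by simp [mgf_id_gaussianReal]

end SubGaussian

section LinearForms

variable {ι : Type*} [Fintype ι] {μ ν : Measure ℝ}

lemma isProper_gaussianReal : IsProper (gaussianReal 0 1) where
  isProbabilityMeasure := inferInstance
  memLp_three := memLp_id_gaussianReal 3
  moment_one := integral_id_gaussianReal
  moment_two := by
    rw [← variance_of_integral_eq_zero (X := fun x => x) (by fun_prop) integral_id_gaussianReal]
    exact variance_fun_id_gaussianReal
  moment_three := by
    have symmetric : ∫ x, x ^ 3 ∂(gaussianReal 0 1) = ∫ x, (-x) ^ 3 ∂(gaussianReal 0 1) := by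
      conv_lhs => rw [← neg_zero, ← gaussianReal_map_neg, integral_map (by fun_prop) (by fun_prop)]
    rw [integral_congr_ae (.of_forall fun x => Odd.neg_pow (by decide) x), integral_neg]
      at symmetric
    linarith

lemma IsProper.haveEqualMoments (hμ : IsProper μ) (hν : IsProper ν) : HaveEqualMoments 3 μ ν := by
  have := hμ.isProbabilityMeasure
  have := hν.isProbabilityMeasure
  intro m hm
  interval_cases m
  · simp
  · simp only [pow_one, hμ.moment_one, hν.moment_one]
  · rw [hμ.moment_two, hν.moment_two]
  · rw [hμ.moment_three, hν.moment_three]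

lemma IsProper.variance_dotProduct (hμ : IsProper μ) (u : ι → ℝ) :
    Var[fun x => u ⬝ᵥ x; Measure.pi fun _ => μ] = ∑ i, u i ^ 2 := by
  have := hμ.isProbabilityMeasure
  have variance_id : Var[fun x : ℝ => x; μ] = 1 := by
    rw [variance_of_integral_eq_zero (by fun_prop) hμ.moment_one, hμ.moment_two]
  have memLp_two : MemLp (fun x : ℝ => x) 2 μ := hμ.memLp_three.mono_exponent (by norm_num)
  have sum_variance := variance_sum_pi (μ := fun _ : ι => μ) (X := fun i x => u i * x)
    fun i => memLp_two.const_mul (u i)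
  have term_variance (i : ι) : Var[fun x : ℝ => u i * x; μ] = u i ^ 2 := by
    rw [variance_const_mul, variance_id, mul_one]
  simp only [term_variance] at sum_variance
  rw [← sum_variance]
  congr 1
  ext x
  simp [dotProduct]

lemma IsProper.integral_dotProduct (hμ : IsProper μ) (u : ι → ℝ) :
    ∫ x, u ⬝ᵥ x ∂(Measure.pi fun _ : ι => μ) = 0 := by
  have := hμ.isProbabilityMeasure
  have integrable_id : Integrable (fun x : ℝ => x) μ := hμ.memLp_three.integrable (by norm_num)
  have integrable_eval (i : ι) : Integrable (fun x : ι → ℝ => x i) (Measure.pi fun _ => μ) :=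
    integrable_comp_eval (f := fun x => x) integrable_id
  simp only [dotProduct]
  rw [integral_finsetSum _ fun i _ => (integrable_eval i).const_mul (u i)]
  refine Finset.sum_eq_zero fun i _ => ?_
  rw [integral_const_mul, integral_comp_eval (μ := fun _ : ι => μ) (f := fun x => x) (by fun_prop),
    hμ.moment_one, mul_zero]

lemma IsProper.eLpNorm_two_dotProduct (hμ : IsProper μ) (u : ι → ℝ) :
    eLpNorm (fun x => u ⬝ᵥ x) 2 (Measure.pi fun _ => μ) = ENNReal.ofReal √(∑ i, u i ^ 2) := by
  have := hμ.isProbabilityMeasure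
  have memLp_two : MemLp (fun x => u ⬝ᵥ x) 2 (Measure.pi fun _ : ι => μ) :=
    memLp_finsetSum _ fun i _ =>
      ((hμ.memLp_three.mono_exponent (by norm_num)).comp_measurePreserving
        (measurePreserving_eval (fun _ => μ) i)).const_mul (u i)
  have integral_sq : ∫ x, (u ⬝ᵥ x) ^ 2 ∂(Measure.pi fun _ : ι => μ) = ∑ i, u i ^ 2 := by
    rw [← variance_of_integral_eq_zero memLp_two.aestronglyMeasurable.aemeasurable
      (hμ.integral_dotProduct u), hμ.variance_dotProduct]
  rw [memLp_two.eLpNorm_eq_integral_rpow_norm two_ne_zero ENNReal.ofNat_ne_top]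
  simp only [ENNReal.toReal_ofNat, Real.rpow_ofNat, Real.norm_eq_abs, sq_abs, integral_sq]
  rw [Real.sqrt_eq_rpow, one_div]

lemma IsProper.isHypercontractive_of_hasSubgaussianMGF (hμ : IsProper μ) {v : NNReal}
    (h : HasSubgaussianMGF id v μ) : IsHypercontractive μ := by
  have := hμ.isProbabilityMeasure
  refine ⟨4 * √v, fun m u q hq => ?_⟩
  rw [hμ.eLpNorm_two_dotProduct, ← ENNReal.ofReal_mul (by positivity)]
  refine (eLpNorm_le_of_hasSubgaussianMGF (hasSubgaussianMGF_dotProduct h u)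
    (by linarith)).trans_eq ?_
  rw [← Finset.sum_mul, NNReal.coe_mul, mul_comm (NNReal.toReal _), Real.sqrt_mul v.coe_nonneg]
  simp only [NNReal.coe_sum, NNReal.coe_pow, coe_nnnorm, Real.norm_eq_abs, sq_abs]
  ring_nf

lemma isHypercontractive_gaussianReal : IsHypercontractive (gaussianReal 0 1) :=
  isProper_gaussianReal.isHypercontractive_of_hasSubgaussianMGF hasSubgaussianMGF_id_gaussianReal

lemma IsHypercontractive.exists_eLpNorm_dotProduct_le (hμ' : IsHypercontractive μ)
    (hμ : IsProper μ) :
    ∃ c, 0 < c ∧ ∀ (n : ℕ) (u : Fin n → ℝ) (q : ℝ), 2 ≤ q →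
      eLpNorm (fun x => u ⬝ᵥ x) (ENNReal.ofReal q) (Measure.pi fun _ => μ) ≤
        ENNReal.ofReal (c * √q * √(∑ i, u i ^ 2)) := by
  obtain ⟨c, hc⟩ := hμ'
  refine ⟨max c 1, by positivity, fun n u q hq => (hc n u q hq).trans ?_⟩
  rw [hμ.eLpNorm_two_dotProduct, ENNReal.ofReal_mul (p := max c 1 * √q) (by positivity)]
  gcongr
  exact le_max_left _ _

lemma IsHypercontractive.memLp_id (hμ' : IsHypercontractive μ) (hμ : IsProper μ) :
    MemLp id 4 μ := by
  have := hμ.isProbabilityMeasure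
  obtain ⟨c, -, hc⟩ := hμ'.exists_eLpNorm_dotProduct_le hμ
  have finite := (hc 1 (fun _ => 1) 4 (by norm_num)).trans_lt ENNReal.ofReal_lt_top
  refine ⟨aestronglyMeasurable_id, ?_⟩
  rw [← eLpNorm_comp_measurePreserving (by fun_prop)
    (measurePreserving_eval (fun _ : Fin 1 => μ) 0)]
  simpa [dotProduct, Function.comp_def] using finite

lemma IsHypercontractive.exists_integral_norm_pow_four_le (hμ' : IsHypercontractive μ)
    (hμ : IsProper μ) :
    ∃ K, 0 < K ∧ ∀ (n k : ℕ), 2 ≤ k → ∀ (u : Fin k → Fin n → ℝ) (M : ℝ),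
      (∀ p, ∑ i, u p i ^ 2 ≤ M) →
      ∫ x, ‖fun p => u p ⬝ᵥ x‖ ^ 4 ∂(Measure.pi fun _ => μ) ≤ K * Real.log k ^ 2 * M ^ 2 := by
  have := hμ.isProbabilityMeasure
  obtain ⟨c, hc0, hc⟩ := hμ'.exists_eLpNorm_dotProduct_le hμ
  refine ⟨(Real.exp 1 * c) ^ 4 * 144, by positivity, fun n k hk u M hM => ?_⟩
  have log_ge := half_le_log_natCast hk
  have M_nonneg : 0 ≤ M :=
    (Finset.sum_nonneg fun i _ => sq_nonneg _).trans (hM ⟨0, by omega⟩)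
  -- an exponent of order `log k` makes the factor `k ^ (1 / q)` harmless
  set q := 4 * (1 + Real.log k) with q_eq
  have four_le : 4 ≤ q := by rw [q_eq]; linarith
  have measurable : AEStronglyMeasurable (fun x p => u p ⬝ᵥ x) (Measure.pi fun _ => μ) :=
    (continuous_pi fun p => by fun_prop).aestronglyMeasurable
  have coordinate_le (p : Fin k) :
      eLpNorm (fun x => u p ⬝ᵥ x) (ENNReal.ofReal q) (Measure.pi fun _ => μ) ≤
        ENNReal.ofReal (c * √q * √M) :=
    (hc n (u p) q (by linarith only [four_le])).trans (by gcongr; exact hM p)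
  have eLpNorm_le : eLpNorm (fun x p => u p ⬝ᵥ x) (4 : ℕ) (Measure.pi fun _ => μ) ≤
      ENNReal.ofReal (Real.exp 1 * (c * √q * √M)) := by
    refine (eLpNorm_le_eLpNorm_of_exponent_le ?_ measurable).trans
      ((eLpNorm_pi_le (by linarith) (by positivity) (by fun_prop) coordinate_le).trans ?_)
    · rw [← ENNReal.ofReal_natCast]
      exact ENNReal.ofReal_le_ofReal (mod_cast four_le)
    · gcongr
      rw [Fintype.card_fin]
      exact natCast_rpow_one_div_le_exp_one (by omega) (by linarith) (by linarith)
  refine (integral_norm_pow_le_of_eLpNorm_le four_ne_zero (by positivity) measurable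
    eLpNorm_le).trans ?_
  have sqrt_pow_four {y : ℝ} (hy : 0 ≤ y) : √y ^ 4 = y ^ 2 := by
    rw [show 4 = 2 * 2 from rfl, pow_mul, Real.sq_sqrt hy]
  calc (Real.exp 1 * (c * √q * √M)) ^ 4 = (Real.exp 1 * c) ^ 4 * q ^ 2 * M ^ 2 := by
        rw [← sqrt_pow_four M_nonneg, ← sqrt_pow_four (y := q) (by linarith)]
        ring
    _ ≤ (Real.exp 1 * c) ^ 4 * (12 * Real.log k) ^ 2 * M ^ 2 := by
        gcongr
        linarith
    _ = _ := by ring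

end LinearForms

section InvariancePrinciple

lemma IsRegularVec.sq_le {n : ℕ} {ε : ℝ} {u : Fin n → ℝ} (h : IsRegularVec ε u) (hε : 0 ≤ ε)
    (hu : ‖WithLp.toLp 2 u‖ ≤ 1) (i : Fin n) : u i ^ 2 ≤ ε := by
  refine le_of_sq_le_sq ?_ hε
  calc (u i ^ 2) ^ 2 = u i ^ 4 := by ring
    _ ≤ ∑ j, u j ^ 4 := Finset.single_le_sum (f := fun j => u j ^ 4)
        (fun j _ => by positivity) (Finset.mem_univ i)
    _ ≤ ε ^ 2 * ‖WithLp.toLp 2 u‖ ^ 2 := h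
    _ ≤ ε ^ 2 := mul_le_of_le_one_right (sq_nonneg ε) (pow_le_one₀ (norm_nonneg _) hu)

lemma sum_sq_le_one {n : ℕ} {u : Fin n → ℝ} (hu : ‖WithLp.toLp 2 u‖ ≤ 1) : ∑ i, u i ^ 2 ≤ 1 := by
  rw [← EuclideanSpace.real_norm_sq_eq (WithLp.toLp 2 u)]
  exact pow_le_one₀ (norm_nonneg _) hu

lemma dotProduct_indicator {ι : Type*} [Fintype ι] (u x : ι → ℝ) (s : Set ι) :
    u ⬝ᵥ s.indicator x = s.indicator u ⬝ᵥ x := by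
  classical
  simp only [dotProduct, Set.indicator_apply, mul_ite, ite_mul, mul_zero, zero_mul]

lemma sum_sq_indicator {ι κ : Type*} [Fintype ι] [DecidableEq κ] (c : ι → κ) (j : κ)
    (u : ι → ℝ) : ∑ i, {i | c i = j}.indicator u i ^ 2 = ∑ i with c i = j, u i ^ 2 := by
  rw [Finset.sum_filter]
  refine Finset.sum_congr rfl fun i _ => ?_
  by_cases hi : c i = j <;> simp [hi]

lemma exists_le_mul_mul_log_one_div {ε₀ : ℝ} (hε₀ : ε₀ < 1) :
    ∃ K, 0 < K ∧ ∀ ε, 0 < ε → ε ≤ ε₀ → ε ≤ K * (ε * Real.log (1 / ε)) := by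
  rcases le_or_gt ε₀ 0 with h0 | h0
  · exact ⟨1, one_pos, fun ε hε hε' => absurd (hε.trans_le hε') h0.not_gt⟩
  have log_pos : 0 < Real.log (1 / ε₀) := Real.log_pos (one_lt_one_div h0 hε₀)
  refine ⟨(Real.log (1 / ε₀))⁻¹, inv_pos.2 log_pos, fun ε hε hε' => ?_⟩
  rw [le_inv_mul_iff₀ log_pos, mul_comm]
  gcongr

theorem theorem3p2_general {μ ν : Measure ℝ} (hμ : IsProper μ) (hμ' : IsHypercontractive μ)
    (hν : IsProper ν) (hν' : IsHypercontractive ν) :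
    ∃ C : ℝ, 0 < C ∧
      ∀ (n k : ℕ), 2 ≤ k →
      ∀ (W : Matrix (Fin n) (Fin k) ℝ), (∀ p, ‖WithLp.toLp 2 (W.col p)‖ ≤ 1) →
      ∀ (ε : ℝ), 0 < ε → IsRegularMatrix ε W →
      ∀ (ψ : (Fin k → ℝ) → ℝ), ContDiff ℝ 4 ψ → fourthDerivNorm ψ < ⊤ →
        Integrable (fun x : Fin n → ℝ => ψ (Wᵀ *ᵥ x)) (Measure.pi fun _ => μ) ∧
        Integrable (fun y : Fin n → ℝ => ψ (Wᵀ *ᵥ y)) (Measure.pi fun _ => ν) ∧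
        |(∫ x : Fin n → ℝ, ψ (Wᵀ *ᵥ x) ∂(Measure.pi fun _ => μ)) -
            ∫ y : Fin n → ℝ, ψ (Wᵀ *ᵥ y) ∂(Measure.pi fun _ => ν)| ≤
          C * (fourthDerivNorm ψ).toReal * Real.log k ^ 3 * ε := by
  have := hμ.isProbabilityMeasure
  have := hν.isProbabilityMeasure
  obtain ⟨K, hK, moment_μ⟩ := hμ'.exists_integral_norm_pow_four_le hμ
  obtain ⟨K', hK', moment_ν⟩ := hν'.exists_integral_norm_pow_four_le hν
  refine ⟨(K + K') * 100 / 24, by positivity, fun n k hk W hW ε hε hreg ψ hψ hfin => ?_⟩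
  have deriv_le := norm_iteratedFDeriv_four_le_fourthDerivNorm hψ hfin
  let L : (Fin n → ℝ) →L[ℝ] Fin k → ℝ := LinearMap.toContinuousLinearMap (Matrix.mulVecLin Wᵀ)
  have L_apply (x : Fin n → ℝ) : L x = Wᵀ *ᵥ x := rfl
  have integrable {ρ : Measure ℝ} (hρ : IsProper ρ) (hρ' : IsHypercontractive ρ) :
      Integrable (fun x => ψ (Wᵀ *ᵥ x)) (Measure.pi fun _ : Fin n => ρ) := by
    have := hρ.isProbabilityMeasure
    simpa only [zero_add, L_apply] using
      integrable_comp_add (d := 3) (fun _ => hρ'.memLp_id hρ) hψ deriv_le 0 L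
  refine ⟨integrable hμ hμ', integrable hν hν', ?_⟩
  obtain ⟨T, c, M, mass_le, sum_M_sq_le⟩ := exists_balanced_colouring (a := fun i p => W i p ^ 2)
    (by rwa [Fintype.card_fin]) hε (fun i p => sq_nonneg _)
    (fun i p => (hreg p).sq_le hε.le (hW p) i) fun p => sum_sq_le_one (hW p)
  have block_eq (j : Fin T) (x : Fin n → ℝ) : L ({i | c i = j}.indicator x) =
      fun p => {i | c i = j}.indicator (W.col p) ⬝ᵥ x :=
    funext fun p => dotProduct_indicator (W.col p) x {i | c i = j}
  have block_mass_le (j : Fin T) (p : Fin k) :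
      ∑ i, {i | c i = j}.indicator (W.col p) i ^ 2 ≤ M j :=
    (sum_sq_indicator c j _).trans_le (mass_le j p)
  have lindeberg := norm_integral_comp_sub_le_sum (d := 3) c (fun _ => hμ'.memLp_id hμ)
    (fun _ => hν'.memLp_id hν) (fun _ => hμ.haveEqualMoments hν) hψ deriv_le L
  simp only [block_eq] at lindeberg
  rw [Fintype.card_fin] at sum_M_sq_le
  set B := (fourthDerivNorm ψ).toReal
  calc _ ≤ _ := lindeberg
    _ ≤ ∑ j, B / 24 * (K * Real.log k ^ 2 * M j ^ 2 + K' * Real.log k ^ 2 * M j ^ 2) := by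
        gcongr with j
        · simp [Nat.factorial]
        · exact moment_μ n k hk _ _ (block_mass_le j)
        · exact moment_ν n k hk _ _ (block_mass_le j)
    _ = B / 24 * (K + K') * Real.log k ^ 2 * ∑ j, M j ^ 2 := by
        rw [Finset.mul_sum]
        exact Finset.sum_congr rfl fun j _ => by ring
    _ ≤ B / 24 * (K + K') * Real.log k ^ 2 * (100 * (ε * Real.log k)) := by gcongr
    _ = _ := by ring

end InvariancePrinciple

theorem theorem3p2 (μ : Measure ℝ) (hμ : IsProper μ) (hμ' : IsHypercontractive μ)
    (ε₀ : ℝ) (hε₀ : ε₀ < 1) :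
    ∃ C : ℝ, 0 < C ∧
      ∀ (n k : ℕ), 2 ≤ k →
      ∀ (W : Matrix (Fin n) (Fin k) ℝ), (∀ p, ‖WithLp.toLp 2 (W.col p)‖ = 1) →
      ∀ (ε : ℝ), 0 < ε → ε ≤ ε₀ → IsRegularMatrix ε W →
      ∀ (ψ : (Fin k → ℝ) → ℝ), ContDiff ℝ ∞ ψ → fourthDerivNorm ψ < ⊤ →
        Integrable (fun x : Fin n → ℝ => ψ (Wᵀ *ᵥ x)) (Measure.pi fun _ => μ) ∧
        Integrable (fun y : Fin n → ℝ => ψ (Wᵀ *ᵥ y)) (Measure.pi fun _ => gaussianReal 0 1) ∧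
        |(∫ x : Fin n → ℝ, ψ (Wᵀ *ᵥ x) ∂(Measure.pi fun _ => μ)) -
            ∫ y : Fin n → ℝ, ψ (Wᵀ *ᵥ y) ∂(Measure.pi fun _ => gaussianReal 0 1)| ≤
          C * (fourthDerivNorm ψ).toReal * Real.log k ^ 3 * (ε * Real.log (1 / ε)) := by
  obtain ⟨C, hC, bound⟩ :=
    theorem3p2_general hμ hμ' isProper_gaussianReal isHypercontractive_gaussianReal
  obtain ⟨K, hK, le_mul_log⟩ := exists_le_mul_mul_log_one_div hε₀
  refine ⟨C * K, by positivity, fun n k hk W hW ε hε hε' hreg ψ hψ hfin => ?_⟩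
  refine (bound n k hk W (fun p => (hW p).le) ε hε hreg ψ (hψ.of_le (by norm_cast)) hfin).imp_right
    (And.imp_right fun diff_le => diff_le.trans ?_)
  refine (mul_le_mul_of_nonneg_left (le_mul_log ε hε hε') (by positivity)).trans_eq ?_
  ring
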